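/- Let $n\ge 1$ be an integer, and consider the shifted staircase diagram of shape $(2n-1,2n-3,\ldots,3,1)$, i.e. the set of the $n^2$ cells $(i,j)$ with $1\le i\le n$ and $i\le j\le 2n-i$, where $i$ is the row index and $j$ the column index. A standard Young tableau of this shape is a bijective labelling of the cells by $1,2,\ldots,n^2$ that increases along each row (in $j$) and down each column (in $i$). Let $T$ be chosen uniformly at random among all these tableaux. The maximal label $n^2$ of $T$ necessarily lies in a cell of the form $(n-S,n+S)$ with $0\le S\le n-1$; this defines the random variable $S$. Then for every integer $r$ with $0\le r\le n-1$, \[ \mathbb{P}(S=r)=\frac{(2r+1)(2n-2r-1)}{n^2}\cdot\frac{b(r)^2\,b(n-r-1)\,b(2r+1)}{b(2r)\,b(r+n)}, \qquad\text{where } b(k)=\frac{1}{2^{2k}}\binom{2k}{k}. \] -/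

import Mathlib

open MeasureTheory ProbabilityTheory

namespace ShiftedTableau

/-- The Young diagram of the shifted shape `(lam 1, …, lam n)`: the cells `(i, j)` with
`1 ≤ i ≤ n` and `i ≤ j < lam i + i` (row index first). -/
def shiftedDiagram (n : ℕ) (lam : ℕ → ℕ) : Finset (ℕ × ℕ) :=
  (Finset.Icc 1 n).biUnion fun i => {i} ×ˢ Finset.Ico i (lam i + i)

/-- The shifted staircase `(2n-1, 2n-3, …, 3, 1)`: row `i` has `2n+1-2i` cells, `1 ≤ i ≤ n`. -/
def staircase (n : ℕ) : Finset (ℕ × ℕ) :=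
  shiftedDiagram n fun i => 2 * n + 1 - 2 * i

theorem mem_staircase {n i j : ℕ} :
    (i, j) ∈ staircase n ↔ 1 ≤ i ∧ i ≤ n ∧ i ≤ j ∧ i + j ≤ 2 * n := by
  simp only [staircase, shiftedDiagram, Finset.mem_biUnion, Finset.mem_product,
    Finset.mem_singleton, Finset.mem_Icc, Finset.mem_Ico]
  constructor
  · rintro ⟨k, hk, rfl, h⟩
    omega
  · intro h
    exact ⟨i, by omega, rfl, by omega⟩

theorem card_staircase (n : ℕ) : (staircase n).card = n ^ 2 := by
  have hd : ∀ i ∈ Finset.Icc 1 n, ∀ j ∈ Finset.Icc 1 n, i ≠ j →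
      Disjoint (({i} : Finset ℕ) ×ˢ Finset.Ico i (2 * n + 1 - 2 * i + i))
        ({j} ×ˢ Finset.Ico j (2 * n + 1 - 2 * j + j)) := by
    intro i _ j _ hij
    rw [Finset.disjoint_left]
    rintro ⟨a, c⟩ h1 h2
    simp only [Finset.mem_product, Finset.mem_singleton] at h1 h2
    exact hij (h1.1.symm.trans h2.1)
  rw [staircase, shiftedDiagram, Finset.card_biUnion hd]
  simp only [Finset.card_product, Finset.card_singleton, one_mul, Nat.card_Ico,
    Nat.add_sub_cancel]
  have key : ∀ m ≤ n, ∑ i ∈ Finset.Icc 1 m, (2 * n + 1 - 2 * i) + m ^ 2 = 2 * n * m := by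
    intro m
    induction m with
    | zero => simp
    | succ k ih =>
      intro hk
      rw [Finset.sum_Icc_succ_top (by omega)]
      have := ih (by omega)
      have h2 : 2 * n + 1 - 2 * (k + 1) + (2 * k + 1) = 2 * n := by omega
      nlinarith
  have := key n le_rfl
  nlinarith

/-- Standard Young tableaux of shape `μ`: the cells of `μ` carry the labels `1, …, |μ|`, each
exactly once, and labels increase along rows and down columns. Labels off `μ` are set to `0`, so
that a tableau is determined by its labels on `μ`. -/
@[ext]
structure StandardTableau (μ : Finset (ℕ × ℕ)) where
  label : ℕ × ℕ → ℕ
  bijOn : Set.BijOn label (μ : Set (ℕ × ℕ)) (Set.Icc 1 μ.card)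
  row_lt : ∀ {i j j' : ℕ}, j < j' → (i, j) ∈ μ → (i, j') ∈ μ → label (i, j) < label (i, j')
  col_lt : ∀ {i i' j : ℕ}, i < i' → (i, j) ∈ μ → (i', j) ∈ μ → label (i, j) < label (i', j)
  label_off : ∀ c, c ∉ μ → label c = 0

/-- Every set of tableaux is an event. -/
instance instMeasurableSpace (μ : Finset (ℕ × ℕ)) : MeasurableSpace (StandardTableau μ) := ⊤

/-- The maximal label `n²` sits in exactly one cell, and this cell is `(n - s, n + s)` for some
`0 ≤ s < n`. -/
theorem existsUnique_position {n : ℕ} (hn : 0 < n) (T : StandardTableau (staircase n)) :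
    ∃! s : ℕ, s < n ∧ T.label (n - s, n + s) = n ^ 2 := by
  have hb := T.bijOn
  rw [card_staircase] at hb
  obtain ⟨⟨i, j⟩, hc, hl⟩ := hb.surjOn (show n ^ 2 ∈ Set.Icc 1 (n ^ 2) from
    ⟨Nat.one_le_pow _ _ hn, le_rfl⟩)
  have hc' : (i, j) ∈ staircase n := hc
  have hm := mem_staircase.1 hc'
  have hij : i + j = 2 * n := by
    by_contra hne
    have hr : (i, j + 1) ∈ staircase n := mem_staircase.2 (by omega)
    have h1 := T.row_lt (show j < j + 1 by omega) hc' hr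
    have h2 := (hb.mapsTo (show (i, j + 1) ∈ (staircase n : Set (ℕ × ℕ)) from hr)).2
    omega
  refine ⟨n - i, ⟨by omega, ?_⟩, ?_⟩
  · have e1 : n - (n - i) = i := by omega
    have e2 : n + (n - i) = j := by omega
    rw [e1, e2, hl]
  · rintro s ⟨hs, hsl⟩
    have hmem : (n - s, n + s) ∈ staircase n := mem_staircase.2 (by omega)
    have := hb.injOn (show (n - s, n + s) ∈ (staircase n : Set (ℕ × ℕ)) from hmem) hc
      (hsl.trans hl.symm)
    have h2 := (Prod.mk.inj this).1
    omega

/-- The random variable `S`: `(n - S T, n + S T)` is the cell of `T` with the maximal label. -/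
noncomputable def S {n : ℕ} (hn : 0 < n) (T : StandardTableau (staircase n)) : ℕ :=
  (existsUnique_position hn T).choose

theorem S_spec {n : ℕ} (hn : 0 < n) (T : StandardTableau (staircase n)) :
    S hn T < n ∧ T.label (n - S hn T, n + S hn T) = n ^ 2 :=
  (existsUnique_position hn T).choose_spec.1

/-- The uniform probability measure on the standard Young tableaux of staircase shape. -/
noncomputable def P (n : ℕ) : Measure (StandardTableau (staircase n)) :=
  uniformOn Set.univ

/-- `b(r) = C(2r, r) / 2^{2r}`. -/
noncomputable def b (r : ℕ) : ℝ := ((2 * r).choose r : ℝ) / 2 ^ (2 * r)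

end ShiftedTableau

/-! The cell with the maximal label is a corner, and deleting it leaves an arbitrary tableau of the
smaller shape. So P(S = r) is the number of tableaux after the row of length 2r+1 loses its last
cell, divided by the number of all tableaux. Both counts come from Schur's product formula N!/∏ λ_i!
· ∏_{i<j} (λ_i - λ_j)/(λ_i + λ_j), where N = ∑ λ_i (`card_standardTableau_shiftedDiagram`). It is
proved by checking that the product obeys the same corner-deletion recursion as the count. This
reduces to the rational identity `sum_mul_prod_stepRatio`, an instance of Lagrange interpolation. In
the quotient for the staircase only the factors of the shortened row survive; `prod_stepRatio_odd`
evaluates them by central binomial coefficients. -/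

namespace ShiftedTableau

/-! ### Corners and deletion of the maximal label -/

/-- A corner of `μ`: a cell with no cell of `μ` to its right in its row or below it in its
column. -/
def IsCorner (μ : Finset (ℕ × ℕ)) (c : ℕ × ℕ) : Prop :=
  c ∈ μ ∧ (∀ j, (c.1, j) ∈ μ → j ≤ c.2) ∧ ∀ i, (i, c.2) ∈ μ → i ≤ c.1

namespace StandardTableau

variable {μ : Finset (ℕ × ℕ)}

theorem label_le (T : StandardTableau μ) (c : ℕ × ℕ) : T.label c ≤ μ.card := by
  by_cases hc : c ∈ μ
  · exact (T.bijOn.mapsTo hc).2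
  · simp [T.label_off c hc]

instance : Finite (StandardTableau μ) := by
  refine Finite.of_injective
    (fun (T : StandardTableau μ) (c : μ) => (⟨T.label c, Nat.lt_succ_of_le (T.label_le c)⟩ :
      Fin (μ.card + 1))) ?_
  intro T T' h
  ext c
  by_cases hc : c ∈ μ
  · simpa using congrFun h ⟨c, hc⟩
  · rw [T.label_off c hc, T'.label_off c hc]

theorem mem_of_label_eq_card (hμ : μ.Nonempty) {T : StandardTableau μ} {c : ℕ × ℕ}
    (h : T.label c = μ.card) : c ∈ μ := by
  by_contra hc
  have := T.label_off c hc
  have := hμ.card_pos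
  omega

theorem isCorner_of_label_eq_card (hμ : μ.Nonempty) {T : StandardTableau μ} {c : ℕ × ℕ}
    (h : T.label c = μ.card) : IsCorner μ c := by
  have hc := mem_of_label_eq_card hμ h
  refine ⟨hc, fun j hj => ?_, fun i hi => ?_⟩
  · by_contra! hlt
    have h1 := T.row_lt hlt hc hj
    have h2 := T.label_le (c.1, j)
    rw [Prod.mk.eta] at h1
    omega
  · by_contra! hlt
    have h1 := T.col_lt hlt hc hi
    have h2 := T.label_le (i, c.2)
    rw [Prod.mk.eta] at h1
    omega

theorem existsUnique_label_eq_card (hμ : μ.Nonempty) (T : StandardTableau μ) :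
    ∃! c, T.label c = μ.card := by
  obtain ⟨c, -, hl⟩ := T.bijOn.surjOn (show μ.card ∈ Set.Icc 1 μ.card from ⟨hμ.card_pos, le_rfl⟩)
  exact ⟨c, hl, fun d hd => T.bijOn.injOn (mem_of_label_eq_card hμ hd)
    (mem_of_label_eq_card hμ hl) (hd.trans hl.symm)⟩

/-- Deleting the cell with the maximal label. -/
def eraseMax {c : ℕ × ℕ} (hc : c ∈ μ) (T : StandardTableau μ) (hT : T.label c = μ.card) :
    StandardTableau (μ.erase c) where
  label d := if d = c then 0 else T.label d
  bijOn := by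
    have hcard := Finset.card_erase_add_one hc
    refine ⟨fun d hd => ?_, fun d hd e he h => ?_, fun k hk => ?_⟩
    · have hd' := Finset.mem_erase.1 (Finset.mem_coe.1 hd)
      have h1 := T.bijOn.mapsTo (Finset.mem_coe.2 hd'.2)
      have h2 : T.label d ≠ μ.card := fun h =>
        hd'.1 (T.bijOn.injOn hd'.2 hc (h.trans hT.symm))
      simp only [if_neg hd'.1, Set.mem_Icc] at h1 ⊢
      omega
    · have hd' := Finset.mem_erase.1 (Finset.mem_coe.1 hd)
      have he' := Finset.mem_erase.1 (Finset.mem_coe.1 he)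
      simp only [if_neg hd'.1, if_neg he'.1] at h
      exact T.bijOn.injOn hd'.2 he'.2 h
    · simp only [Set.mem_Icc] at hk
      obtain ⟨d, hd, hdk⟩ := T.bijOn.surjOn (show k ∈ Set.Icc 1 μ.card from ⟨hk.1, by omega⟩)
      have hdc : d ≠ c := by
        rintro rfl
        omega
      exact ⟨d, Finset.mem_coe.2 (Finset.mem_erase.2 ⟨hdc, hd⟩), by simp [hdc, hdk]⟩
  row_lt hj h1 h2 := by
    rw [Finset.mem_erase] at h1 h2
    simpa only [if_neg h1.1, if_neg h2.1] using T.row_lt hj h1.2 h2.2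
  col_lt hj h1 h2 := by
    rw [Finset.mem_erase] at h1 h2
    simpa only [if_neg h1.1, if_neg h2.1] using T.col_lt hj h1.2 h2.2
  label_off d hd := by
    split_ifs with h
    · rfl
    · exact T.label_off d fun hd' => hd (Finset.mem_erase.2 ⟨h, hd'⟩)

/-- Adding a corner and giving it the maximal label. -/
def addMax {c : ℕ × ℕ} (hc : IsCorner μ c) (T : StandardTableau (μ.erase c)) :
    StandardTableau μ where
  label d := if d = c then μ.card else T.label d
  bijOn := by
    have hcard := Finset.card_erase_add_one hc.1
    have hmem : ∀ {d}, d ≠ c → d ∈ μ → 1 ≤ T.label d ∧ T.label d < μ.card := by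
      intro d hdc hd
      have := T.bijOn.mapsTo (Finset.mem_coe.2 (Finset.mem_erase.2 ⟨hdc, hd⟩))
      rw [Set.mem_Icc] at this
      omega
    refine ⟨fun d hd => ?_, fun d hd e he h => ?_, fun k hk => ?_⟩
    · by_cases hdc : d = c
      · simp only [if_pos hdc, Set.mem_Icc]
        omega
      · have := hmem hdc hd
        simp only [if_neg hdc, Set.mem_Icc]
        omega
    · by_cases hdc : d = c <;> by_cases hec : e = c
      · rw [hdc, hec]
      · have := hmem hec he
        simp only [if_pos hdc, if_neg hec] at h
        omega
      · have := hmem hdc hd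
        simp only [if_neg hdc, if_pos hec] at h
        omega
      · simp only [if_neg hdc, if_neg hec] at h
        exact T.bijOn.injOn (Finset.mem_coe.2 (Finset.mem_erase.2 ⟨hdc, hd⟩))
          (Finset.mem_coe.2 (Finset.mem_erase.2 ⟨hec, he⟩)) h
    · rw [Set.mem_Icc] at hk
      rcases hk.2.eq_or_lt with rfl | hlt
      · exact ⟨c, hc.1, by simp⟩
      · obtain ⟨d, hd, hdk⟩ := T.bijOn.surjOn
          (show k ∈ Set.Icc 1 (μ.erase c).card from ⟨hk.1, by omega⟩)
        have hd' := Finset.mem_erase.1 (Finset.mem_coe.1 hd)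
        exact ⟨d, hd'.2, by simp [hd'.1, hdk]⟩
  row_lt {i j j'} hj h1 h2 := by
    have hcard := Finset.card_erase_add_one hc.1
    -- A corner has nothing to its right, so `c` can only be the larger of the two cells.
    have h1c : (i, j) ≠ c := by
      rintro rfl
      exact absurd (hc.2.1 j' h2) (not_le.2 hj)
    rw [if_neg h1c]
    split_ifs with h2c
    · have := T.label_le (i, j)
      omega
    · exact T.row_lt hj (Finset.mem_erase.2 ⟨h1c, h1⟩) (Finset.mem_erase.2 ⟨h2c, h2⟩)
  col_lt {i i' j} hi h1 h2 := by
    have hcard := Finset.card_erase_add_one hc.1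
    have h1c : (i, j) ≠ c := by
      rintro rfl
      exact absurd (hc.2.2 i' h2) (not_le.2 hi)
    rw [if_neg h1c]
    split_ifs with h2c
    · have := T.label_le (i, j)
      omega
    · exact T.col_lt hi (Finset.mem_erase.2 ⟨h1c, h1⟩) (Finset.mem_erase.2 ⟨h2c, h2⟩)
  label_off d hd := by
    have hdc : d ≠ c := fun h => hd (h ▸ hc.1)
    rw [if_neg hdc]
    exact T.label_off d fun h => hd (Finset.mem_of_mem_erase h)

/-- Tableaux with the maximal label in the corner `c` are tableaux of the shape without `c`. -/
def maxAtEquiv {c : ℕ × ℕ} (hc : IsCorner μ c) :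
    {T : StandardTableau μ // T.label c = μ.card} ≃ StandardTableau (μ.erase c) where
  toFun T := eraseMax hc.1 T.1 T.2
  invFun T := ⟨addMax hc T, by simp [addMax]⟩
  left_inv := by
    rintro ⟨T, hT⟩
    ext d
    by_cases h : d = c <;> simp [addMax, eraseMax, h, hT]
  right_inv T := by
    ext d
    by_cases h : d = c
    · simp [addMax, eraseMax, h, T.label_off c (Finset.notMem_erase c μ)]
    · simp [addMax, eraseMax, h]

/-- The set `s` may contain cells that are not corners, since these contribute zero. This allows a
sum over the ends of all rows. -/
theorem card_eq_sum_label_eq_card (hμ : μ.Nonempty) {s : Finset (ℕ × ℕ)}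
    (hs : ∀ c, IsCorner μ c → c ∈ s) :
    Nat.card (StandardTableau μ) =
      ∑ c ∈ s, Nat.card {T : StandardTableau μ // T.label c = μ.card} := by
  classical
  have := Fintype.ofFinite (StandardTableau μ)
  choose pos hpos hpos' using fun T : StandardTableau μ => T.existsUnique_label_eq_card hμ
  rw [Nat.card_eq_fintype_card, ← Finset.card_univ,
    Finset.card_eq_sum_card_fiberwise (f := pos) (t := s)
      fun T _ => hs _ (isCorner_of_label_eq_card hμ (hpos T))]
  refine Finset.sum_congr rfl fun c _ => ?_
  rw [Nat.card_eq_fintype_card, Fintype.card_subtype]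
  congr 1
  ext T
  simp only [Finset.mem_filter, Finset.mem_univ, true_and]
  exact ⟨fun h => h ▸ hpos T, fun h => (hpos' T c h).symm⟩

theorem card_empty : Nat.card (StandardTableau ∅) = 1 := by
  rw [Nat.card_eq_one_iff_unique]
  refine ⟨⟨fun T T' => ?_⟩, ⟨⟨fun _ => 0, by simp, by simp, by simp, by simp⟩⟩⟩
  ext c
  rw [T.label_off c (by simp), T'.label_off c (by simp)]

end StandardTableau

/-! ### The interpolation identity -/

/-- The second coefficients of `∏ (X - z j)` and `∏ (X - y j)`, compared by interpolation at the
nodes `y`. -/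
theorem sum_prod_sub_div_prod_sub {ι F : Type*} [DecidableEq ι] [Field F] {s : Finset ι}
    {y : ι → F} (z : ι → F) (hy : Set.InjOn y s) :
    ∑ i ∈ s, (∏ j ∈ s, (y i - z j)) / ∏ j ∈ s.erase i, (y i - y j) = ∑ i ∈ s, (y i - z i) := by
  rcases s.eq_empty_or_nonempty with rfl | hs
  · simp
  -- Both products are monic of degree `s.card`, so their difference is determined by its values at
  -- the `s.card` nodes `y`.
  open Polynomial in
  have hdeg : (∏ j ∈ s, (X - C (z j)) - ∏ j ∈ s, (X - C (y j))).degree < (s.card : WithBot ℕ) := by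
    have hz : (∏ j ∈ s, (X - C (z j))).degree = (s.card : WithBot ℕ) := by
      simp [degree_prod]
    have hy : (∏ j ∈ s, (X - C (y j))).degree = (s.card : WithBot ℕ) := by
      simp [degree_prod]
    rw [← hz]
    refine degree_sub_lt_left (hz.trans hy.symm) (monic_prod_X_sub_C z s).ne_zero ?_
    rw [(monic_prod_X_sub_C z s).leadingCoeff, (monic_prod_X_sub_C y s).leadingCoeff]
  have h := Lagrange.coeff_eq_sum hy hdeg
  rw [Polynomial.coeff_sub, Polynomial.prod_X_sub_C_coeff_card_pred s z hs.card_pos,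
    Polynomial.prod_X_sub_C_coeff_card_pred s y hs.card_pos] at h
  rw [Finset.sum_sub_distrib, show ∑ i ∈ s, y i - ∑ i ∈ s, z i
    = -∑ i ∈ s, z i - -∑ i ∈ s, y i by ring, h]
  refine Finset.sum_congr rfl fun i hi => ?_
  have h0 : ∏ j ∈ s, (y i - y j) = 0 := Finset.prod_eq_zero hi (sub_self _)
  simp [Polynomial.eval_prod, h0]

/-- The ratio of `x ↦ (x - u) / (x + u)` at `a - 1` and at `a`. -/
noncomputable def stepRatio (a u : ℝ) : ℝ := (a - 1 - u) * (a + u) / ((a - 1 + u) * (a - u))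

/-- Take y_i = a_i(a_i - 1) and z_i = a_i(a_i + 1). Then y_i - z_j = (a_i - 1 - a_j)(a_i + a_j) and
y_i - y_j = (a_i - a_j)(a_i - 1 + a_j), whose quotient is the step ratio. The diagonal terms y_i -
z_i = -2a_i supply the weights, and `hadd` keeps the nodes distinct. -/
theorem sum_mul_prod_stepRatio {ι : Type*} [DecidableEq ι] {s : Finset ι} {a : ι → ℝ}
    (ha : Set.InjOn a s) (hadd : ∀ i ∈ s, ∀ j ∈ s, i ≠ j → a i + a j ≠ 1) :
    ∑ i ∈ s, a i * ∏ j ∈ s.erase i, stepRatio (a i) (a j) = ∑ i ∈ s, a i := by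
  have hy : Set.InjOn (fun i => a i * (a i - 1)) s := by
    intro i hi j hj h
    by_contra hij
    have h1 : (a i - a j) * (a i + a j - 1) = 0 := by linear_combination h
    rcases mul_eq_zero.1 h1 with h2 | h2
    · exact hij (ha hi hj (sub_eq_zero.1 h2))
    · exact hadd i hi j hj hij (by linarith)
  have h := sum_prod_sub_div_prod_sub (fun i => a i * (a i + 1)) hy
  have h2 : ∑ i ∈ s, (a i * (a i - 1) - a i * (a i + 1)) = -2 * ∑ i ∈ s, a i := by
    rw [Finset.mul_sum]
    exact Finset.sum_congr rfl fun i _ => by ring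
  rw [h2] at h
  have h3 : -2 * ∑ i ∈ s, a i * ∏ j ∈ s.erase i, stepRatio (a i) (a j)
      = -2 * ∑ i ∈ s, a i := by
    rw [← h, Finset.mul_sum]
    refine Finset.sum_congr rfl fun i hi => ?_
    rw [← Finset.mul_prod_erase s _ hi, mul_div_assoc, ← Finset.prod_div_distrib]
    have : ∏ j ∈ s.erase i, stepRatio (a i) (a j) = ∏ j ∈ s.erase i,
        (a i * (a i - 1) - a j * (a j + 1)) / (a i * (a i - 1) - a j * (a j - 1)) := by
      refine Finset.prod_congr rfl fun j _ => ?_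
      rw [stepRatio]
      congr 1 <;> ring
    rw [this]
    ring
  linarith

/-! ### The pair product when one variable changes -/

/-- The product of `(a i - a j) / (a i + a j)` over `1 ≤ i < j ≤ n`. -/
noncomputable def pairProd (n : ℕ) (a : ℕ → ℝ) : ℝ :=
  ∏ j ∈ Finset.Icc 1 n, ∏ i ∈ Finset.Ico 1 j, (a i - a j) / (a i + a j)

theorem pairProd_succ (n : ℕ) (a : ℕ → ℝ) :
    pairProd (n + 1) a =
      pairProd n a * ∏ i ∈ Finset.Icc 1 n, (a i - a (n + 1)) / (a i + a (n + 1)) := by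
  rw [pairProd, Finset.prod_Icc_succ_top (by omega), pairProd]
  rfl

theorem pairProd_congr {n : ℕ} {a a' : ℕ → ℝ} (h : ∀ i ∈ Finset.Icc 1 n, a i = a' i) :
    pairProd n a = pairProd n a' := by
  refine Finset.prod_congr rfl fun j hj => Finset.prod_congr rfl fun i hi => ?_
  rw [Finset.mem_Icc] at hj
  rw [Finset.mem_Ico] at hi
  rw [h i (Finset.mem_Icc.2 (by omega)), h j (Finset.mem_Icc.2 (by omega))]

/-- Only pairs containing `m` change. The cross-multiplied form needs no nonvanishing assumption, so
the induction on `n` runs freely. -/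
theorem pairProd_update_mul {n m : ℕ} (hm : m ∈ Finset.Icc 1 n) (a : ℕ → ℝ) (x : ℝ) :
    pairProd n (Function.update a m x) *
        ∏ j ∈ (Finset.Icc 1 n).erase m, (a m - a j) / (a m + a j) =
      pairProd n a * ∏ j ∈ (Finset.Icc 1 n).erase m, (x - a j) / (x + a j) := by
  induction n with
  | zero => simp at hm
  | succ n ih =>
    have hmem : n + 1 ∉ Finset.Icc 1 n := by simp
    have hins : Finset.Icc 1 (n + 1) = insert (n + 1) (Finset.Icc 1 n) :=
      (Finset.insert_Icc_right_eq_Icc_add_one (by omega)).symm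
    rw [pairProd_succ, pairProd_succ]
    by_cases hmn : m = n + 1
    · subst hmn
      rw [hins, Finset.erase_insert hmem, Function.update_self]
      have h1 : pairProd n (Function.update a (n + 1) x) = pairProd n a :=
        pairProd_congr fun i hi => by
          rw [Function.update_of_ne]
          rintro rfl
          exact hmem hi
      -- Here `m` is the later index of each pair, so every factor changes sign; both sides acquire
      -- the same power of -1.
      have h2 : ∏ i ∈ Finset.Icc 1 n, (Function.update a (n + 1) x i - x) /
          (Function.update a (n + 1) x i + x) = ∏ i ∈ Finset.Icc 1 n, -((x - a i) / (x + a i)) := by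
        refine Finset.prod_congr rfl fun i hi => ?_
        rw [Function.update_of_ne (by rintro rfl; exact hmem hi), ← neg_div, neg_sub, add_comm x]
      have h3 : ∏ i ∈ Finset.Icc 1 n, (a i - a (n + 1)) / (a i + a (n + 1)) =
          ∏ i ∈ Finset.Icc 1 n, -((a (n + 1) - a i) / (a (n + 1) + a i)) := by
        refine Finset.prod_congr rfl fun i hi => ?_
        rw [← neg_div, neg_sub, add_comm (a (n + 1))]
      rw [h1, h2, h3, Finset.prod_neg, Finset.prod_neg]
      ring
    · have hm' : m ∈ Finset.Icc 1 n := by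
        rw [Finset.mem_Icc] at hm ⊢
        omega
      have hne : n + 1 ∉ (Finset.Icc 1 n).erase m := fun h => hmem (Finset.mem_of_mem_erase h)
      rw [hins, Finset.erase_insert_of_ne (Ne.symm hmn), Finset.prod_insert hne,
        Finset.prod_insert hne, Function.update_of_ne (Ne.symm hmn),
        ← Finset.mul_prod_erase _ _ hm', ← Finset.mul_prod_erase (Finset.Icc 1 n)
          (fun i => (a i - a (n + 1)) / (a i + a (n + 1))) hm', Function.update_self]
      have h2 : ∏ i ∈ (Finset.Icc 1 n).erase m, (Function.update a m x i - a (n + 1)) /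
          (Function.update a m x i + a (n + 1)) =
          ∏ i ∈ (Finset.Icc 1 n).erase m, (a i - a (n + 1)) / (a i + a (n + 1)) := by
        refine Finset.prod_congr rfl fun i hi => ?_
        rw [Function.update_of_ne (Finset.ne_of_mem_erase hi)]
      rw [h2]
      linear_combination ((x - a (n + 1)) / (x + a (n + 1)) *
        (∏ i ∈ (Finset.Icc 1 n).erase m, (a i - a (n + 1)) / (a i + a (n + 1))) *
        ((a m - a (n + 1)) / (a m + a (n + 1)))) * ih hm'

theorem pairProd_update {n m : ℕ} (hm : m ∈ Finset.Icc 1 n) {a : ℕ → ℝ}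
    (hsub : ∀ j ∈ (Finset.Icc 1 n).erase m, a m - a j ≠ 0)
    (hadd : ∀ j ∈ (Finset.Icc 1 n).erase m, a m + a j ≠ 0) :
    pairProd n (Function.update a m (a m - 1)) =
      pairProd n a * ∏ j ∈ (Finset.Icc 1 n).erase m, stepRatio (a m) (a j) := by
  have h := pairProd_update_mul hm a (a m - 1)
  have h0 : ∏ j ∈ (Finset.Icc 1 n).erase m, (a m - a j) / (a m + a j) ≠ 0 :=
    Finset.prod_ne_zero_iff.2 fun j hj => div_ne_zero (hsub j hj) (hadd j hj)
  rw [← mul_right_inj' h0, mul_comm, h, mul_left_comm, ← Finset.prod_mul_distrib]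
  congr 1
  refine Finset.prod_congr rfl fun j hj => ?_
  have h1 := hsub j hj
  have h2 := hadd j hj
  rw [stepRatio, div_mul_div_comm]
  -- Only `a m - a j` and `a m + a j` are cancelled. The factor `a m - 1 - a j` may vanish, as it
  -- does when the shortened row meets the next one.
  rw [show (a m - a j) * ((a m - 1 - a j) * (a m + a j)) =
    (a m - 1 - a j) * ((a m - a j) * (a m + a j)) by ring,
    show (a m + a j) * ((a m - 1 + a j) * (a m - a j)) =
    (a m - 1 + a j) * ((a m - a j) * (a m + a j)) by ring,
    mul_div_mul_right _ _ (mul_ne_zero h1 h2)]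

/-! ### Corners of shifted diagrams -/

theorem mem_shiftedDiagram {n i j : ℕ} {lam : ℕ → ℕ} :
    (i, j) ∈ shiftedDiagram n lam ↔ (1 ≤ i ∧ i ≤ n) ∧ i ≤ j ∧ j < lam i + i := by
  simp only [shiftedDiagram, Finset.mem_biUnion, Finset.mem_product,
    Finset.mem_singleton, Finset.mem_Icc, Finset.mem_Ico]
  constructor
  · rintro ⟨k, hk, rfl, h⟩
    exact ⟨hk, h⟩
  · rintro ⟨h1, h2⟩
    exact ⟨i, h1, rfl, h2⟩

theorem card_shiftedDiagram (n : ℕ) (lam : ℕ → ℕ) :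
    (shiftedDiagram n lam).card = ∑ i ∈ Finset.Icc 1 n, lam i := by
  rw [shiftedDiagram, Finset.card_biUnion]
  · simp
  · intro i _ j _ hij
    rw [Function.onFun, Finset.disjoint_left]
    rintro ⟨a, c⟩ h1 h2
    simp only [Finset.mem_product, Finset.mem_singleton] at h1 h2
    exact hij (h1.1.symm.trans h2.1)

theorem shiftedDiagram_succ_of_eq_zero {n : ℕ} {lam : ℕ → ℕ} (h : lam (n + 1) = 0) :
    shiftedDiagram (n + 1) lam = shiftedDiagram n lam := by
  ext ⟨i, j⟩
  rw [mem_shiftedDiagram, mem_shiftedDiagram]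
  constructor
  · rintro ⟨h1, h2⟩
    have : i ≠ n + 1 := by
      rintro rfl
      omega
    omega
  · omega

theorem shiftedDiagram_erase_last {n i : ℕ} {lam : ℕ → ℕ} :
    (shiftedDiagram n lam).erase (i, lam i + i - 1) =
      shiftedDiagram n (Function.update lam i (lam i - 1)) := by
  ext ⟨k, j⟩
  rw [Finset.mem_erase, mem_shiftedDiagram, mem_shiftedDiagram, Ne, Prod.mk.injEq]
  by_cases hk : k = i
  · subst hk
    rw [Function.update_self]
    omega
  · rw [Function.update_of_ne hk]
    omega

/-- Each step down shortens the row by at least one and shifts it by exactly one, so row ends never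
move to the right. -/
theorem add_le_add_of_strictAntiOn {n : ℕ} {lam : ℕ → ℕ}
    (hlam : StrictAntiOn lam (Set.Icc 1 n)) {i k : ℕ} (hi : 1 ≤ i) (hik : i ≤ k) (hk : k ≤ n) :
    lam k + k ≤ lam i + i := by
  induction k, hik using Nat.le_induction with
  | base => rfl
  | succ k hik ih =>
    have := hlam (show k ∈ Set.Icc 1 n from ⟨by omega, by omega⟩)
      (show k + 1 ∈ Set.Icc 1 n from ⟨by omega, hk⟩) (by omega)
    have := ih (by omega)
    omega

theorem IsCorner.eq_last {n : ℕ} {lam : ℕ → ℕ} {c : ℕ × ℕ}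
    (hc : IsCorner (shiftedDiagram n lam) c) :
    c.1 ∈ Finset.Icc 1 n ∧ c = (c.1, lam c.1 + c.1 - 1) := by
  obtain ⟨i, j⟩ := c
  obtain ⟨h, hrow, -⟩ := hc
  rw [mem_shiftedDiagram] at h
  have := hrow (lam i + i - 1) (mem_shiftedDiagram.2 (by dsimp only; omega))
  dsimp only at this ⊢
  refine ⟨Finset.mem_Icc.2 h.1, ?_⟩
  rw [Prod.mk.injEq]
  omega

/-- Row `i` ends in column `lam i + i - 1` and row `i + 1` in column `lam (i + 1) + i`. The
condition says that the lower row ends strictly further left, equivalently that the rows stay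
strictly decreasing after the deletion. -/
theorem isCorner_last_iff {n i : ℕ} {lam : ℕ → ℕ} (hlam : StrictAntiOn lam (Set.Icc 1 n))
    (hpos : ∀ k ∈ Finset.Icc 1 n, 0 < lam k) (hi : i ∈ Finset.Icc 1 n) :
    IsCorner (shiftedDiagram n lam) (i, lam i + i - 1) ↔ (i < n → lam (i + 1) + 1 < lam i) := by
  have hp := hpos i hi
  rw [Finset.mem_Icc] at hi
  constructor
  · rintro ⟨-, -, hcol⟩ hin
    by_contra! hle
    have hp' := hpos (i + 1) (Finset.mem_Icc.2 (by omega))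
    have hlt := hlam (show i ∈ Set.Icc 1 n from hi)
      (show i + 1 ∈ Set.Icc 1 n from ⟨by omega, by omega⟩) (by omega)
    have := hcol (i + 1) (mem_shiftedDiagram.2 (by dsimp only; omega))
    dsimp only at this
    omega
  · intro h
    refine ⟨mem_shiftedDiagram.2 (by omega), fun j hj => ?_, fun k hk => ?_⟩
    · rw [mem_shiftedDiagram] at hj
      dsimp only at hj ⊢
      omega
    · rw [mem_shiftedDiagram] at hk
      dsimp only at hk ⊢
      by_contra! hik
      have := add_le_add_of_strictAntiOn hlam (show 1 ≤ i + 1 by omega) hik hk.1.2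
      have := h (by omega)
      omega

theorem strictAntiOn_update_pred {n i : ℕ} {lam : ℕ → ℕ} (hlam : StrictAntiOn lam (Set.Icc 1 n))
    (hpos : ∀ k ∈ Finset.Icc 1 n, 0 < lam k) (hi : i ∈ Finset.Icc 1 n)
    (h : i < n → lam (i + 1) + 1 < lam i) :
    StrictAntiOn (Function.update lam i (lam i - 1)) (Set.Icc 1 n) := by
  intro j hj k hk hjk
  have hlt := hlam hj hk hjk
  have hp := hpos i hi
  rw [Finset.mem_Icc] at hi
  rw [Set.mem_Icc] at hj hk
  by_cases hji : j = i
  · subst hji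
    rw [Function.update_self, Function.update_of_ne (by omega)]
    have := h (by omega)
    have := hlam.antitoneOn (show j + 1 ∈ Set.Icc 1 n from ⟨by omega, by omega⟩) hk
      (show j + 1 ≤ k from hjk)
    omega
  · rw [Function.update_of_ne hji]
    by_cases hki : k = i
    · subst hki
      rw [Function.update_self]
      omega
    · rwa [Function.update_of_ne hki]

/-! ### Schur's product formula -/

/-- The number of standard tableaux of the shifted shape `(lam 1, …, lam n)`, in product form. -/
noncomputable def shiftedCount (n : ℕ) (lam : ℕ → ℕ) : ℝ :=
  (∑ i ∈ Finset.Icc 1 n, lam i).factorial / (∏ i ∈ Finset.Icc 1 n, ((lam i).factorial : ℝ)) *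
    pairProd n fun i => lam i

theorem shiftedCount_succ_of_eq_zero {n : ℕ} {lam : ℕ → ℕ} (h : lam (n + 1) = 0)
    (hpos : ∀ k ∈ Finset.Icc 1 n, 0 < lam k) :
    shiftedCount (n + 1) lam = shiftedCount n lam := by
  have h1 : ∏ i ∈ Finset.Icc 1 n, ((lam i : ℝ) - lam (n + 1)) / (lam i + lam (n + 1)) = 1 := by
    refine Finset.prod_eq_one fun i hi => ?_
    have := hpos i hi
    rw [h, Nat.cast_zero, sub_zero, add_zero, div_self (by positivity)]
  rw [shiftedCount, shiftedCount, pairProd_succ, h1, Finset.sum_Icc_succ_top (by omega),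
    Finset.prod_Icc_succ_top (by omega), h]
  simp

/-- The factorials contribute `lam i` over the size, the pair product contributes the step ratios.
Row `i` need not end in a corner. -/
theorem shiftedCount_update_pred {n i : ℕ} {lam : ℕ → ℕ} (hlam : StrictAntiOn lam (Set.Icc 1 n))
    (hpos : ∀ k ∈ Finset.Icc 1 n, 0 < lam k) (hi : i ∈ Finset.Icc 1 n) :
    shiftedCount n (Function.update lam i (lam i - 1)) =
      shiftedCount n lam / (∑ k ∈ Finset.Icc 1 n, lam k : ℕ) *
        (lam i * ∏ j ∈ (Finset.Icc 1 n).erase i, stepRatio (lam i) (lam j)) := by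
  have hp := hpos i hi
  have hcast : (fun k => ((Function.update lam i (lam i - 1) k : ℕ) : ℝ)) =
      Function.update (fun k => (lam k : ℝ)) i ((lam i : ℝ) - 1) := by
    ext k
    by_cases hk : k = i
    · subst hk
      simp [Nat.cast_sub (show 1 ≤ lam k from hp)]
    · simp [Function.update_of_ne hk]
  have hV : pairProd n (Function.update (fun k => (lam k : ℝ)) i ((lam i : ℝ) - 1)) =
      pairProd n (fun k => (lam k : ℝ)) *
        ∏ j ∈ (Finset.Icc 1 n).erase i, stepRatio (lam i) (lam j) := by
    refine pairProd_update (a := fun k => (lam k : ℝ)) hi (fun j hj => ?_) (fun j hj => ?_)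
    · rw [Finset.mem_erase] at hj
      rw [sub_ne_zero, Ne, Nat.cast_inj]
      exact fun h => hj.1 (hlam.injOn (Finset.mem_Icc.1 hj.2) (Finset.mem_Icc.1 hi) h.symm)
    · positivity
  have hsum : ∑ k ∈ Finset.Icc 1 n, lam k =
      ∑ k ∈ Finset.Icc 1 n, Function.update lam i (lam i - 1) k + 1 := by
    have h : ∑ k ∈ (Finset.Icc 1 n).erase i, Function.update lam i (lam i - 1) k =
        ∑ k ∈ (Finset.Icc 1 n).erase i, lam k :=
      Finset.sum_congr rfl fun k hk => Function.update_of_ne (Finset.ne_of_mem_erase hk) _ _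
    rw [← Finset.add_sum_erase _ _ hi, ← Finset.add_sum_erase _ (Function.update _ _ _) hi,
      Function.update_self, h]
    omega
  have hprod : ∏ k ∈ Finset.Icc 1 n, ((lam k).factorial : ℝ) =
      lam i * ∏ k ∈ Finset.Icc 1 n, ((Function.update lam i (lam i - 1) k).factorial : ℝ) := by
    rw [← Finset.mul_prod_erase _ _ hi, ← Finset.mul_prod_erase (Finset.Icc 1 n)
      (fun k => ((Function.update lam i (lam i - 1) k).factorial : ℝ)) hi,
      Function.update_self, ← mul_assoc, ← Nat.cast_mul, Nat.mul_factorial_pred hp.ne']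
    congr 1
    refine Finset.prod_congr rfl fun k hk => ?_
    rw [Function.update_of_ne (Finset.ne_of_mem_erase hk)]
  rw [shiftedCount, shiftedCount, hcast, hV, hprod, hsum, Nat.factorial_succ]
  have h0 : (∏ k ∈ Finset.Icc 1 n,
      ((Function.update lam i (lam i - 1) k).factorial : ℝ)) ≠ 0 :=
    Finset.prod_ne_zero_iff.2 fun k _ => by positivity
  have h1 : (lam i : ℝ) ≠ 0 := by positivity
  push_cast
  field_simp

/-- Shortening a row that does not end in a corner makes it as long as the next row, which kills a
factor. Such rows can therefore stay in the recursion. -/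
theorem shiftedCount_update_pred_eq_zero {n i : ℕ} {lam : ℕ → ℕ}
    (hlam : StrictAntiOn lam (Set.Icc 1 n)) (hpos : ∀ k ∈ Finset.Icc 1 n, 0 < lam k)
    (hi : i ∈ Finset.Icc 1 n) (h : ¬(i < n → lam (i + 1) + 1 < lam i)) :
    shiftedCount n (Function.update lam i (lam i - 1)) = 0 := by
  push Not at h
  rw [shiftedCount_update_pred hlam hpos hi]
  rw [Finset.mem_Icc] at hi
  have hlt := hlam (show i ∈ Set.Icc 1 n from hi)
    (show i + 1 ∈ Set.Icc 1 n from ⟨by omega, by omega⟩) (by omega)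
  have h1 : lam i = lam (i + 1) + 1 := by omega
  rw [Finset.prod_eq_zero (i := i + 1)]
  · simp
  · rw [Finset.mem_erase, Finset.mem_Icc]
    omega
  · simp [stepRatio, h1]

theorem sum_shiftedCount_update_pred {n : ℕ} {lam : ℕ → ℕ}
    (hlam : StrictAntiOn lam (Set.Icc 1 n)) (hpos : ∀ k ∈ Finset.Icc 1 n, 0 < lam k)
    (hn : 0 < n) :
    ∑ i ∈ Finset.Icc 1 n, shiftedCount n (Function.update lam i (lam i - 1)) =
      shiftedCount n lam := by
  rw [Finset.sum_congr rfl fun i hi => shiftedCount_update_pred hlam hpos hi, ← Finset.mul_sum,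
    sum_mul_prod_stepRatio (a := fun i => (lam i : ℝ)), Nat.cast_sum, div_mul_cancel₀]
  · exact (Finset.sum_pos (fun i hi => Nat.cast_pos.2 (hpos i hi))
      ⟨1, Finset.mem_Icc.2 ⟨le_rfl, hn⟩⟩).ne'
  · intro i hi j hj h
    exact hlam.injOn (by simpa using hi) (by simpa using hj) (Nat.cast_injective h)
  · intro i hi j hj _ h
    have := hpos i hi
    have := hpos j hj
    have : lam i + lam j = 1 := by exact_mod_cast h
    omega

theorem card_standardTableau_shiftedDiagram {n : ℕ} {lam : ℕ → ℕ}
    (hlam : StrictAntiOn lam (Set.Icc 1 n)) :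
    (Nat.card (StandardTableau (shiftedDiagram n lam)) : ℝ) = shiftedCount n lam := by
  -- The summand `n` makes the measure drop also when an empty last row is discarded, which leaves
  -- the size unchanged.
  induction hN : n + ∑ i ∈ Finset.Icc 1 n, lam i using Nat.strong_induction_on
    generalizing n lam with
  | _ N ih =>
    rcases Nat.eq_zero_or_pos n with rfl | hn
    · have : shiftedDiagram 0 lam = ∅ := by simp [shiftedDiagram]
      rw [this, StandardTableau.card_empty]
      simp [shiftedCount, pairProd]
    obtain ⟨m, rfl⟩ : ∃ m, n = m + 1 := ⟨n - 1, by omega⟩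
    have hpos' : ∀ k ∈ Finset.Icc 1 m, 0 < lam k := by
      intro k hk
      rw [Finset.mem_Icc] at hk
      have := hlam (show k ∈ Set.Icc 1 (m + 1) from ⟨by omega, by omega⟩)
        (show m + 1 ∈ Set.Icc 1 (m + 1) from ⟨by omega, by omega⟩) (by omega)
      omega
    -- Strict decrease allows only the last row to be empty, as happens after a row of length one is
    -- deleted.
    rcases Nat.eq_zero_or_pos (lam (m + 1)) with h0 | h0
    · rw [shiftedDiagram_succ_of_eq_zero h0, shiftedCount_succ_of_eq_zero h0 hpos']
      refine ih _ ?_ (hlam.mono (Set.Icc_subset_Icc_right (by omega))) rfl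
      rw [← hN, Finset.sum_Icc_succ_top (by omega)]
      omega
    have hpos : ∀ k ∈ Finset.Icc 1 (m + 1), 0 < lam k := by
      intro k hk
      by_cases hkm : k = m + 1
      · rwa [hkm]
      · exact hpos' k (by rw [Finset.mem_Icc] at hk ⊢; omega)
    have hne : (shiftedDiagram (m + 1) lam).Nonempty :=
      ⟨(1, 1), mem_shiftedDiagram.2
        (by have := hpos 1 (Finset.mem_Icc.2 (by omega)); omega)⟩
    have hcorner : ∀ c, IsCorner (shiftedDiagram (m + 1) lam) c →
        c ∈ (Finset.Icc 1 (m + 1)).image fun i => (i, lam i + i - 1) := fun c hc =>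
      Finset.mem_image.2 ⟨c.1, hc.eq_last.1, hc.eq_last.2.symm⟩
    rw [StandardTableau.card_eq_sum_label_eq_card hne hcorner,
      Finset.sum_image fun i _ j _ h => (Prod.mk.inj h).1, Nat.cast_sum,
      ← sum_shiftedCount_update_pred hlam hpos hn]
    refine Finset.sum_congr rfl fun i hi => ?_
    by_cases hc : i < m + 1 → lam (i + 1) + 1 < lam i
    · rw [Nat.card_congr (StandardTableau.maxAtEquiv ((isCorner_last_iff hlam hpos hi).2 hc)),
        shiftedDiagram_erase_last]
      refine ih _ ?_ (strictAntiOn_update_pred hlam hpos hi hc) rfl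
      rw [← hN]
      refine Nat.add_lt_add_left (Finset.sum_lt_sum (fun k _ => ?_) ⟨i, hi, ?_⟩) _
      · by_cases hk : k = i
        · subst hk
          simp
        · rw [Function.update_of_ne hk]
      · have := hpos i hi
        rw [Function.update_self]
        omega
    · rw [shiftedCount_update_pred_eq_zero hlam hpos hi hc, Nat.cast_eq_zero,
        Nat.card_eq_zero]
      left
      exact ⟨fun T => hc ((isCorner_last_iff hlam hpos hi).1
        (StandardTableau.isCorner_of_label_eq_card hne T.2))⟩

/-! ### Products of central binomial ratios -/

theorem b_pos (k : ℕ) : 0 < b k := by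
  have : 0 < (2 * k).choose k := Nat.choose_pos (by omega)
  rw [b]
  positivity

theorem b_succ (k : ℕ) : b (k + 1) = b k * ((2 * k + 1) / (2 * k + 2)) := by
  have h : ((k : ℝ) + 1) * ((2 * (k + 1)).choose (k + 1) : ℝ) =
      2 * (2 * k + 1) * ((2 * k).choose k : ℝ) := by
    exact_mod_cast Nat.succ_mul_centralBinom_succ k
  have h' : ((2 * (k + 1)).choose (k + 1) : ℝ) =
      2 * (2 * k + 1) * ((2 * k).choose k : ℝ) / (k + 1) := by
    rw [← h]
    field_simp
  rw [b, b, h', show 2 * (k + 1) = 2 * k + 2 by ring, pow_add]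
  field_simp

theorem prod_odd_div_even (r : ℕ) :
    ∏ k ∈ Finset.range r, ((2 * (r : ℝ) - 2 * k - 1) / (2 * r - 2 * k)) = b r := by
  have h : ∀ m, ∏ k ∈ Finset.range m, ((2 * (k : ℝ) + 1) / (2 * k + 2)) = b m := by
    intro m
    induction m with
    | zero => simp [b]
    | succ m ih => rw [Finset.prod_range_succ, ih, b_succ]
  rw [← h r, ← Finset.prod_range_reflect]
  refine Finset.prod_congr rfl fun k hk => ?_
  rw [Finset.mem_range] at hk
  rw [show r - 1 - k = r - (k + 1) by omega, Nat.cast_sub (by omega)]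
  push_cast
  congr 1 <;> ring

/-- The factors are b(r+k)/b(r+k+1), so the product telescopes. -/
theorem prod_even_div_odd (r m : ℕ) :
    ∏ k ∈ Finset.range m, ((2 * (r : ℝ) + 2 * k + 2) / (2 * r + 2 * k + 1)) = b r / b (r + m) := by
  induction m with
  | zero => simp [(b_pos r).ne']
  | succ m ih =>
    have h1 := (b_pos (r + m)).ne'
    rw [Finset.prod_range_succ, ih, ← add_assoc, b_succ]
    push_cast
    field_simp

/-- Induction on `n` from `r + 1`. The factors k < r give b(r) · b(r)/b(2r), and b(2r+1) cancels in
the base case. With n = r+1+d, the new factor k = n is (2d+3)/(2d+2) · b(r+n)/b(r+n+1), and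
(2d+3)/(2d+2) = (2d+3)/(2d+1) · b(d+1)/b(d); this is the source of the linear factor 2n - 2r - 1. -/
theorem prod_stepRatio_odd {n r : ℕ} (hr : r < n) :
    ∏ k ∈ (Finset.range n).erase r, stepRatio (2 * r + 1) (2 * k + 1) =
      (2 * (n : ℝ) - 2 * r - 1) * (b r ^ 2 * b (n - r - 1) * b (2 * r + 1) /
        (b (2 * r) * b (r + n))) := by
  induction n, (show r + 1 ≤ n from hr) using Nat.le_induction with
  | base =>
    rw [Finset.range_add_one, Finset.erase_insert Finset.notMem_range_self]
    have h : ∏ k ∈ Finset.range r, stepRatio (2 * r + 1) (2 * k + 1) =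
        (∏ k ∈ Finset.range r, ((2 * (r : ℝ) - 2 * k - 1) / (2 * r - 2 * k))) *
        ∏ k ∈ Finset.range r, ((2 * (r : ℝ) + 2 * k + 2) / (2 * r + 2 * k + 1)) := by
      rw [← Finset.prod_mul_distrib]
      refine Finset.prod_congr rfl fun k _ => ?_
      rw [stepRatio, div_mul_div_comm]
      congr 1 <;> ring
    have h1 := (b_pos (2 * r)).ne'
    have h2 := (b_pos (2 * r + 1)).ne'
    rw [h, prod_odd_div_even, prod_even_div_odd, ← two_mul,
      show r + 1 - r - 1 = 0 by omega, show r + (r + 1) = 2 * r + 1 by ring,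
      show b 0 = 1 by simp [b]]
    push_cast
    field_simp
    ring
  | succ n hn ih =>
    rw [Finset.range_add_one, Finset.erase_insert_of_ne (by omega), Finset.prod_insert (by simp),
      ih (by omega)]
    obtain ⟨d, rfl⟩ : ∃ d, n = r + 1 + d := ⟨n - (r + 1), by omega⟩
    rw [show r + 1 + d + 1 - r - 1 = d + 1 by omega, show r + 1 + d - r - 1 = d by omega,
      show r + (r + 1 + d + 1) = (2 * r + 1 + d) + 1 by ring,
      show r + (r + 1 + d) = 2 * r + 1 + d by ring, b_succ d, b_succ (2 * r + 1 + d), stepRatio]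
    have h1 := (b_pos (2 * r)).ne'
    have h2 := (b_pos (2 * r + 1 + d)).ne'
    have h3 : (2 * (r : ℝ) + 1 - (2 * (r + 1 + d : ℝ) + 1)) ≠ 0 := by
      have : (0 : ℝ) < d + 1 := by positivity
      intro h
      linarith
    have h4 : (2 * (r : ℝ) + 1 - 1 + (2 * (r + 1 + d : ℝ) + 1)) ≠ 0 := by
      have : (0 : ℝ) < 4 * r + 2 * d + 3 := by positivity
      intro h
      linarith
    have h5 : (2 * (2 * (r : ℝ) + 1 + d) + 1) ≠ 0 := by positivity
    have h6 : (2 * (2 * (r : ℝ) + 1 + d) + 2) ≠ 0 := by positivity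
    have h7 : (2 * (d : ℝ) + 2) ≠ 0 := by positivity
    push_cast
    field_simp
    ring

/-! ### The staircase and the law of S -/

theorem strictAntiOn_staircase (n : ℕ) :
    StrictAntiOn (fun i => 2 * n + 1 - 2 * i) (Set.Icc 1 n) := by
  intro i hi j hj hij
  rw [Set.mem_Icc] at hi hj
  dsimp only
  omega

theorem staircase_row_pos (n : ℕ) : ∀ k ∈ Finset.Icc 1 n, 0 < 2 * n + 1 - 2 * k := by
  intro k hk
  rw [Finset.mem_Icc] at hk
  omega

theorem card_label_eq_sq {n r : ℕ} (hr : r < n) :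
    (Nat.card {T : StandardTableau (staircase n) // T.label (n - r, n + r) = n ^ 2} : ℝ) =
      Nat.card (StandardTableau (staircase n)) * ((2 * (r : ℝ) + 1) / (n : ℝ) ^ 2 *
        ∏ k ∈ (Finset.range n).erase r, stepRatio (2 * r + 1) (2 * k + 1)) := by
  have hlam := strictAntiOn_staircase n
  have hpos := staircase_row_pos n
  have hi : n - r ∈ Finset.Icc 1 n := Finset.mem_Icc.2 (by omega)
  have hrow : 2 * n + 1 - 2 * (n - r) = 2 * r + 1 := by omega
  have hcell : (n - r, n + r) = (n - r, 2 * n + 1 - 2 * (n - r) + (n - r) - 1) := by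
    rw [Prod.mk.injEq]
    omega
  -- Consecutive rows differ in length by two, so every row ends in a corner.
  have hstep : n - r < n → 2 * n + 1 - 2 * (n - r + 1) + 1 < 2 * n + 1 - 2 * (n - r) := by
    omega
  have hcorner := (isCorner_last_iff hlam hpos hi).2 hstep
  have hsum : ∑ k ∈ Finset.Icc 1 n, (2 * n + 1 - 2 * k) = n ^ 2 := by
    rw [← card_staircase, staircase, card_shiftedDiagram]
  have hprod : ∏ j ∈ (Finset.Icc 1 n).erase (n - r),
      stepRatio ((2 * n + 1 - 2 * (n - r) : ℕ) : ℝ) ((2 * n + 1 - 2 * j : ℕ) : ℝ) =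
      ∏ k ∈ (Finset.range n).erase r, stepRatio (2 * r + 1) (2 * k + 1) := by
    -- Rows are reindexed by k = n - j, so that row j has length 2k+1.
    refine Finset.prod_nbij' (fun j => n - j) (fun k => n - k) ?_ ?_ ?_ ?_ ?_
    all_goals simp only [Finset.mem_erase, Finset.mem_Icc, Finset.mem_range]
    · omega
    · omega
    · omega
    · omega
    · intro j hj
      rw [hrow, show 2 * n + 1 - 2 * j = 2 * (n - j) + 1 by omega]
      push_cast
      rfl
  rw [← card_staircase, hcell, staircase,
    Nat.card_congr (StandardTableau.maxAtEquiv hcorner), shiftedDiagram_erase_last,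
    card_standardTableau_shiftedDiagram hlam,
    card_standardTableau_shiftedDiagram (strictAntiOn_update_pred hlam hpos hi hstep),
    shiftedCount_update_pred hlam hpos hi, hprod, hsum, hrow]
  push_cast
  ring

theorem card_standardTableau_staircase_ne_zero (n : ℕ) :
    (Nat.card (StandardTableau (staircase n)) : ℝ) ≠ 0 := by
  rw [staircase, card_standardTableau_shiftedDiagram (strictAntiOn_staircase n), shiftedCount]
  refine mul_ne_zero (div_ne_zero (by positivity)
    (Finset.prod_ne_zero_iff.2 fun k _ => by positivity)) ?_
  refine Finset.prod_ne_zero_iff.2 fun j hj => Finset.prod_ne_zero_iff.2 fun i hi => ?_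
  rw [Finset.mem_Icc] at hj
  rw [Finset.mem_Ico] at hi
  have h1 := strictAntiOn_staircase n (show i ∈ Set.Icc 1 n from ⟨by omega, by omega⟩)
    (show j ∈ Set.Icc 1 n from hj) hi.2
  have h2 : ((2 * n + 1 - 2 * j : ℕ) : ℝ) < ((2 * n + 1 - 2 * i : ℕ) : ℝ) := Nat.cast_lt.2 h1
  have h3 : (0 : ℝ) ≤ ((2 * n + 1 - 2 * j : ℕ) : ℝ) := Nat.cast_nonneg _
  exact div_ne_zero (by linarith) (by linarith)

theorem S_eq_iff {n r : ℕ} (hn : 0 < n) (hr : r < n) (T : StandardTableau (staircase n)) :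
    S hn T = r ↔ T.label (n - r, n + r) = n ^ 2 := by
  constructor
  · rintro rfl
    exact (S_spec hn T).2
  · intro h
    exact (existsUnique_position hn T).unique (S_spec hn T) ⟨hr, h⟩

theorem P_real_apply (n : ℕ) (A : Set (StandardTableau (staircase n))) :
    (P n).real A = Nat.card A / Nat.card (StandardTableau (staircase n)) := by
  have := Fintype.ofFinite (StandardTableau (staircase n))
  rw [Measure.real, P, uniformOn_univ, ENNReal.toReal_div, Measure.count_apply (by trivial)]
  rw [← A.toFinite.cast_ncard_eq, ENat.toENNReal_coe, ENNReal.toReal_natCast,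
    ENNReal.toReal_natCast, Nat.card_coe_set_eq, Nat.card_eq_fintype_card]

end ShiftedTableau

theorem theorem2 (n : ℕ) (hn : 0 < n) (r : ℕ) (hr : r < n) :
    (ShiftedTableau.P n).real {T | ShiftedTableau.S hn T = r} =
      ((2 * (r : ℝ) + 1) * (2 * (n : ℝ) - 2 * (r : ℝ) - 1)) / (n : ℝ) ^ 2 *
        ((ShiftedTableau.b r ^ 2 * ShiftedTableau.b (n - r - 1) * ShiftedTableau.b (2 * r + 1)) /
          (ShiftedTableau.b (2 * r) * ShiftedTableau.b (r + n))) := by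
  have hset : {T | ShiftedTableau.S hn T = r} =
      {T : ShiftedTableau.StandardTableau (ShiftedTableau.staircase n) |
        T.label (n - r, n + r) = n ^ 2} := by
    ext T
    exact ShiftedTableau.S_eq_iff hn hr T
  rw [hset, ShiftedTableau.P_real_apply, Set.coe_ofPred, ShiftedTableau.card_label_eq_sq hr,
    mul_div_cancel_left₀ _ (ShiftedTableau.card_standardTableau_staircase_ne_zero n),
    ShiftedTableau.prod_stepRatio_odd hr]
  ring
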